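/- Let $n\ge 0$ and let $X$ be a finite multiset of nonzero vectors in $\mathbb R^n$ that spans $\mathbb R^n$; elements are counted with multiplicity, and $X$ is equipped with an arbitrary linear order $\prec$ (repeated vectors being distinct elements of $X$). Let $\Pi=\mathbb C[t_1,\dots,t_n]$. For $y\in\mathbb R^n$ put $p_y=\sum_{k=1}^n y_k t_k\in\Pi$, and for $Y\subseteq X$ put $p_Y=\prod_{y\in Y}p_y$ (with $p_\emptyset=1$). For $S\subseteq X$ let $\mathcal P(S)=\operatorname{span}_{\mathbb C}\{p_Y : Y\subseteq S,\ \operatorname{rank}(S\setminus Y)=n\}$, so that $\mathcal P(S)=\{0\}$ if $S$ does not span $\mathbb R^n$, and let $$\mathcal P_-(X)=\bigcap_{x\in X}\mathcal P(X\setminus x)\subseteq\Pi ,$$ where $X\setminus x$ omits one occurrence of $x$ (for $n=0$, when $X=\emptyset$, the empty intersection is $\Pi$). Let $\mathbb B(X)$ be the set of all $B\subseteq X$ that are bases of $\mathbb R^n$. An element $b$ of $B\in\mathbb B(X)$ is internally active in $B$ if $b=\max_{\prec}\bigl(X\setminus\operatorname{span}(B\setminus b)\bigr)$. Let $\mathbb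 B_-(X)$, the set of internal bases, consist of those $B\in\mathbb B(X)$ that contain no internally active element. For $B\in\mathbb B(X)$ let $$X(B)=\{y\in X : y\notin\operatorname{span}\{b\in B : b\preceq y\}\},\qquad Q_B=p_{X(B)},$$ and let $\mathcal P_{ex}(X)=\operatorname{span}_{\mathbb C}\{Q_B : B\in\mathbb B(X)\setminus\mathbb B_-(X)\}$. **Theorem.** $\mathcal P_-(X)\cap\mathcal P_{ex}(X)=\{0\}$. In particular, $\dim_{\mathbb C}\mathcal P_-(X)\le\#\mathbb B_-(X)$. -/

import Mathlib

namespace Zonotopal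

/-! A finite multiset `X` of vectors in `ℝⁿ` is a family `X : ι → (Fin n → ℝ)` over a finite index
type; submultisets are finsets of indices, and an ordering of `X` is a linear order on `ι`.
The space `Π` of polynomials is `MvPolynomial (Fin n) ℂ`. -/

/-- The linear form `p_y : t ↦ y · t`, as an element of `ℂ[t₁, …, tₙ]`. -/
noncomputable def linForm {n : ℕ} (y : Fin n → ℝ) : MvPolynomial (Fin n) ℂ :=
  ∑ k, MvPolynomial.C ((y k : ℝ) : ℂ) * MvPolynomial.X k

/-- The product `p_Y = ∏_{y ∈ Y} p_y` for a submultiset `Y` of `X`. -/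
noncomputable def prodForm {ι : Type*} {n : ℕ} (X : ι → (Fin n → ℝ)) (Y : Finset ι) :
    MvPolynomial (Fin n) ℂ :=
  ∏ i ∈ Y, linForm (X i)

/-- The central space `𝒫(S)` of a submultiset `S` of `X`: the span of all `p_Y`, `Y ⊆ S`, such that
`S \ Y` has full rank `n`. (It is `0` if `S` itself does not have full rank.) -/
noncomputable def centralSpace {ι : Type*} {n : ℕ} (X : ι → (Fin n → ℝ)) (S : Finset ι) :
    Submodule ℂ (MvPolynomial (Fin n) ℂ) :=
  Submodule.span ℂ
    {p | ∃ Y : Finset ι, Y ⊆ S ∧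
      Submodule.span ℝ (X '' ((S : Set ι) \ (Y : Set ι))) = ⊤ ∧ p = prodForm X Y}

/-- The internal space `𝒫₋(X) = ⋂_{x ∈ X} 𝒫(X \ x)`, where `X \ x` drops one occurrence of `x`. -/
noncomputable def internalSpace {ι : Type*} [Fintype ι] [DecidableEq ι] {n : ℕ}
    (X : ι → (Fin n → ℝ)) : Submodule ℂ (MvPolynomial (Fin n) ℂ) :=
  ⨅ i : ι, centralSpace X (Finset.univ.erase i)

/-- `𝔹(X)`: the submultisets of `X` that are bases of `ℝⁿ`. -/
def bases {ι : Type*} {n : ℕ} (X : ι → (Fin n → ℝ)) : Set (Finset ι) :=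
  {B | LinearIndependent ℝ (fun i : B => X i) ∧ Submodule.span ℝ (X '' (B : Set ι)) = ⊤}

/-- `b` is internally active in `B`: `b = max (X \ H)`, where `H = span (B \ b)`. -/
def InternallyActive {ι : Type*} [LinearOrder ι] {n : ℕ} (X : ι → (Fin n → ℝ))
    (B : Finset ι) (b : ι) : Prop :=
  IsGreatest {i : ι | X i ∉ Submodule.span ℝ (X '' ((B : Set ι) \ {b}))} b

/-- `𝔹₋(X)`: the internal bases, i.e. the bases that contain no internally active vector. -/
def internalBases {ι : Type*} [LinearOrder ι] {n : ℕ} (X : ι → (Fin n → ℝ)) : Set (Finset ι) :=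
  {B | B ∈ bases X ∧ ∀ b ∈ B, ¬ InternallyActive X B b}

open Classical in
/-- `X(B) = {y ∈ X : y ∉ span {b ∈ B : b ⪯ y}}`. -/
noncomputable def passiveSet {ι : Type*} [Fintype ι] [LinearOrder ι] {n : ℕ}
    (X : ι → (Fin n → ℝ)) (B : Finset ι) : Finset ι :=
  Finset.univ.filter fun i => X i ∉ Submodule.span ℝ (X '' {b | b ∈ B ∧ b ≤ i})

/-- The polynomial `Q_B = p_{X(B)}`. -/
noncomputable def basisPoly {ι : Type*} [Fintype ι] [LinearOrder ι] {n : ℕ}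
    (X : ι → (Fin n → ℝ)) (B : Finset ι) : MvPolynomial (Fin n) ℂ :=
  prodForm X (passiveSet X B)

/-- `𝒫_ex(X)`: the span of the polynomials `Q_B`, `B ∈ 𝔹(X) \ 𝔹₋(X)`. -/
noncomputable def exSpace {ι : Type*} [Fintype ι] [LinearOrder ι] {n : ℕ}
    (X : ι → (Fin n → ℝ)) : Submodule ℂ (MvPolynomial (Fin n) ℂ) :=
  Submodule.span ℂ (basisPoly X '' (bases X \ internalBases X))

end Zonotopal

namespace Zonotopal

open Finset

section

variable {ι : Type*} {n : ℕ}

/-! Suppose f = ∑ c_B Q_B, over the non-internal bases, lies in 𝒫₋(X). Let b be internally active in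
a non-internal basis B₀, let η be a normal to span(B₀ \ b), and split X into S = {x : x · η = 0} and
T = {x : x · η ≠ 0}. On lines t + sη every element of 𝒫₋(X) has degree at most #T - 2 in s
(`coeff_lineRestrict_eq_zero`). A basis meets T, and its own elements are never passive, so each Q_B
has degree at most #T - 1. The coefficient of s^(#T-1) in f is therefore a vanishing combination of
products of forms t ↦ y · t over passive sets in S, taken with respect to the traces B ∩ S. Such
products are linearly independent (`coeff_eq_zero_of_sum_passive`), so the contributions with trace
B₀ \ b cancel. They come from bases (B₀ \ b) ∪ z with z ∈ T. As b = max T, those with z ≠ b are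
smaller than B₀, and induction leaves c_{B₀} = 0.

For the dimension bound, straightening puts 𝒫₋(X) inside the span of all Q_B, of dimension at most
#𝔹(X). The independent Q_B with B non-internal span a subspace of it that meets 𝒫₋(X) trivially. -/

open Classical in
/-- The elements `y` of the ground set `S` with `y ∉ span {b ∈ B : b ⪯ y}`. -/
noncomputable def passiveIn [LinearOrder ι] (X : ι → (Fin n → ℝ)) (S B : Finset ι) : Finset ι :=
  S.filter fun i => X i ∉ Submodule.span ℝ (X '' {b | b ∈ B ∧ b ≤ i})

theorem mem_passiveIn [LinearOrder ι] {X : ι → (Fin n → ℝ)} {S B : Finset ι} {i : ι} :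
    i ∈ passiveIn X S B ↔ i ∈ S ∧ X i ∉ Submodule.span ℝ (X '' {b | b ∈ B ∧ b ≤ i}) := by
  simp [passiveIn]

theorem passiveSet_eq [Fintype ι] [LinearOrder ι] (X : ι → (Fin n → ℝ)) (B : Finset ι) :
    passiveSet X B = passiveIn X univ B := rfl

theorem passiveIn_insert_of_mem [LinearOrder ι] {X : ι → (Fin n → ℝ)} {S B : Finset ι} {x : ι}
    (h : X x ∈ Submodule.span ℝ (X '' {b | b ∈ B ∧ b ≤ x})) :
    passiveIn X (insert x S) B = passiveIn X S B := by
  ext i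
  simp only [mem_passiveIn, mem_insert]
  constructor
  · rintro ⟨rfl | hi, h'⟩
    · exact absurd h h'
    · exact ⟨hi, h'⟩
  · rintro ⟨hi, h'⟩
    exact ⟨Or.inr hi, h'⟩

theorem passiveIn_insert_of_notMem [LinearOrder ι] {X : ι → (Fin n → ℝ)} {S B : Finset ι} {x : ι}
    (h : X x ∉ Submodule.span ℝ (X '' {b | b ∈ B ∧ b ≤ x})) :
    passiveIn X (insert x S) B = insert x (passiveIn X S B) := by
  ext i
  simp only [mem_passiveIn, mem_insert]
  constructor
  · rintro ⟨rfl | hi, h'⟩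
    · exact Or.inl rfl
    · exact Or.inr ⟨hi, h'⟩
  · rintro (rfl | ⟨hi, h'⟩)
    · exact ⟨Or.inl rfl, h⟩
    · exact ⟨Or.inr hi, h'⟩

/-! ### Linear independence of products over passive sets -/

/-- A vector outside a subspace is separated from it by some vector. -/
theorem exists_dotProduct_ne_zero {V : Submodule ℝ (Fin n → ℝ)} {x : Fin n → ℝ} (hx : x ∉ V) :
    ∃ v : Fin n → ℝ, x ⬝ᵥ v ≠ 0 ∧ ∀ y ∈ V, y ⬝ᵥ v = 0 := by
  obtain ⟨f, hfx, hf⟩ := Submodule.exists_le_ker_of_notMem hx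
  have key : ∀ y : Fin n → ℝ, y ⬝ᵥ (fun k => f (fun j => if k = j then 1 else 0)) = f y := by
    intro y
    rw [LinearMap.pi_apply_eq_sum_univ f y]
    simp [dotProduct]
  refine ⟨fun k => f (fun j => if k = j then 1 else 0), ?_, fun y hy => ?_⟩
  · rw [key]; exact hfx
  · rw [key]; exact hf hy

theorem dotProduct_eq_zero_of_mem_span {s : Set (Fin n → ℝ)} {v : Fin n → ℝ}
    (h : ∀ y ∈ s, y ⬝ᵥ v = 0) {y : Fin n → ℝ} (hy : y ∈ Submodule.span ℝ s) : y ⬝ᵥ v = 0 := by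
  induction hy using Submodule.span_induction with
  | mem y hy => exact h y hy
  | zero => simp
  | add a b _ _ ha hb => rw [add_dotProduct, ha, hb, add_zero]
  | smul r a _ ha => rw [smul_dotProduct, ha, smul_zero]

/-- The functions `t ↦ ∏ y · t`, over the passive elements `y ∈ S` of `B`, are linearly independent
on the orthogonal complement of `C`, for independent `B` with `C ⊆ B ⊆ C ∪ S`. -/
theorem coeff_eq_zero_of_sum_passive [Fintype ι] [LinearOrder ι] (X : ι → (Fin n → ℝ))
    (S : Finset ι) : ∀ (C : Finset ι) (c : Finset ι → ℂ), (∀ a ∈ C, ∀ s ∈ S, a < s) →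
    (∀ B, c B ≠ 0 → (∀ x ∈ B, X x ∉ Submodule.span ℝ (X '' {b | b ∈ B ∧ b < x})) ∧
      C ⊆ B ∧ B ⊆ C ∪ S) →
    (∀ t : Fin n → ℝ, (∀ a ∈ C, X a ⬝ᵥ t = 0) →
      ∑ B, c B * ∏ i ∈ passiveIn X S B, ((X i ⬝ᵥ t : ℝ) : ℂ) = 0) → ∀ B, c B = 0 := by
  -- The elements of X are processed in increasing order: `C` holds those already forced into every
  -- `B`, and `S` those still undecided, all larger than `C`.
  induction S using Finset.induction_on_min with
  | empty =>
    intro C c _ hc hz B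
    by_contra hB
    have hBC : ∀ B, c B ≠ 0 → B = C := fun B hB => by
      obtain ⟨_, h1, h2⟩ := hc B hB
      exact Subset.antisymm (by simpa using h2) h1
    have h0 := hz 0 (by simp)
    rw [Finset.sum_eq_single C] at h0
    · have : passiveIn X ∅ C = ∅ := by simp [passiveIn]
      rw [this, prod_empty, mul_one] at h0
      rw [hBC B hB] at hB
      exact hB h0
    · intro B' _ hne
      have : c B' = 0 := by
        by_contra h
        exact hne (hBC B' h)
      simp [this]
    · simp
  | insert x S hxS ih =>
    intro C c hCS hc hz
    have hCx : ∀ a ∈ C, a < x := fun a ha => hCS a ha x (mem_insert_self _ _)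
    have hCS' : ∀ a ∈ C, ∀ s ∈ S, a < s := fun a ha s hs => hCS a ha s (mem_insert_of_mem hs)
    have hlt : ∀ B, c B ≠ 0 → {b | b ∈ B ∧ b < x} = (C : Set ι) := by
      intro B hB
      obtain ⟨_, h1, h2⟩ := hc B hB
      ext b
      simp only [Set.mem_ofPred_eq, mem_coe]
      constructor
      · rintro ⟨hb, hbx⟩
        have := h2 hb
        simp only [mem_union, mem_insert] at this
        rcases this with h | rfl | h
        · exact h
        · exact absurd hbx (lt_irrefl _)
        · exact absurd hbx (hxS b h).not_gt
      · intro hb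
        exact ⟨h1 hb, hCx b hb⟩
    have hsub : ∀ B, c B ≠ 0 → x ∉ B → B ⊆ C ∪ S := by
      intro B hB hxB b hb
      have := (hc B hB).2.2 hb
      simp only [mem_union, mem_insert] at this ⊢
      rcases this with h | rfl | h
      · exact Or.inl h
      · exact absurd hb hxB
      · exact Or.inr h
    -- If `X x` depends on `C`, then `x` belongs to no relevant `B` and is passive for none, so it
    -- can be discarded.
    by_cases hx : X x ∈ Submodule.span ℝ (X '' (C : Set ι))
    · have hxB : ∀ B, c B ≠ 0 → x ∉ B := fun B hB hxB => by
        have := (hc B hB).1 x hxB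
        rw [hlt B hB] at this
        exact this hx
      refine ih C c hCS' (fun B hB => ⟨(hc B hB).1, (hc B hB).2.1, hsub B hB (hxB B hB)⟩) ?_
      intro t ht
      rw [← hz t ht]
      refine Finset.sum_congr rfl fun B _ => ?_
      by_cases hB : c B = 0
      · simp [hB]
      · rw [passiveIn_insert_of_mem]
        refine Submodule.span_mono (Set.image_mono ?_) hx
        rw [← hlt B hB]
        exact fun b hb => ⟨hb.1, hb.2.le⟩
    · have hpass : ∀ B, c B ≠ 0 → x ∉ B →
          passiveIn X (insert x S) B = insert x (passiveIn X S B) := by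
        intro B hB hxB
        refine passiveIn_insert_of_notMem fun h => hx ?_
        rw [← hlt B hB]
        refine Submodule.span_mono (Set.image_mono ?_) h
        rintro b ⟨hb, hbx⟩
        exact ⟨hb, lt_of_le_of_ne hbx fun h => hxB (h ▸ hb)⟩
      have hxp : ∀ B, x ∉ passiveIn X S B := fun B h => lt_irrefl x (hxS x (mem_passiveIn.1 h).1)
      -- On the hyperplane `X x ⬝ᵥ t = 0` the terms with `x ∉ B` vanish, since `x` is passive for
      -- them. The terms with `x ∈ B` remain and are handled by induction with `x` moved into `C`.
      have h1 : ∀ B, (if x ∈ B then c B else 0) = 0 := by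
        refine ih (insert x C) (fun B => if x ∈ B then c B else 0) ?_ ?_ ?_
        · intro a ha s hs
          rcases mem_insert.1 ha with rfl | ha
          · exact hxS s hs
          · exact hCS' a ha s hs
        · intro B hB
          have hxB : x ∈ B := by
            by_contra h
            simp [h] at hB
          have hB' : c B ≠ 0 := by simpa [hxB] using hB
          obtain ⟨h1, h2, h3⟩ := hc B hB'
          refine ⟨h1, insert_subset hxB h2, fun b hb => ?_⟩
          have := h3 hb
          simp only [mem_union, mem_insert] at this ⊢
          tauto
        · intro t ht
          refine Eq.trans ?_ (hz t fun a ha => ht a (mem_insert_of_mem ha))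
          refine Finset.sum_congr rfl fun B _ => ?_
          by_cases hB : c B = 0
          · simp [hB]
          by_cases hxB : x ∈ B
          · rw [passiveIn_insert_of_mem
              (Submodule.subset_span (Set.mem_image_of_mem X ⟨hxB, le_rfl⟩))]
            simp [hxB]
          · rw [hpass B hB hxB, prod_insert (hxp B), ht x (mem_insert_self _ _)]
            simp [hxB]
      have hxB : ∀ B, c B ≠ 0 → x ∉ B := fun B hB hxB => hB (by simpa [hxB] using h1 B)
      refine ih C c hCS' (fun B hB => ⟨(hc B hB).1, (hc B hB).2.1, hsub B hB (hxB B hB)⟩) ?_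
      -- Every surviving term has the factor `X x ⬝ᵥ t`. Cancelling it gives `g t = 0` off the
      -- hyperplane, and continuity along a transverse line inside the complement of `C` gives it on
      -- the hyperplane.
      set g : (Fin n → ℝ) → ℂ :=
        fun t => ∑ B, c B * ∏ i ∈ passiveIn X S B, ((X i ⬝ᵥ t : ℝ) : ℂ) with hg
      have hgc : Continuous g := by
        simp only [hg, dotProduct]
        fun_prop
      have hmul : ∀ t, (∀ a ∈ C, X a ⬝ᵥ t = 0) → X x ⬝ᵥ t ≠ 0 → g t = 0 := by
        intro t ht hxt
        have : ((X x ⬝ᵥ t : ℝ) : ℂ) * g t = 0 := by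
          rw [← hz t ht, hg, mul_sum]
          refine Finset.sum_congr rfl fun B _ => ?_
          by_cases hB : c B = 0
          · simp [hB]
          · rw [hpass B hB (hxB B hB), prod_insert (hxp B)]
            ring
        exact (mul_eq_zero.1 this).resolve_left (by exact_mod_cast hxt)
      intro t ht
      change g t = 0
      by_cases hxt : X x ⬝ᵥ t = 0
      · obtain ⟨v, hv, hvC⟩ := exists_dotProduct_ne_zero hx
        have hline : (fun s : ℝ => g (t + s • v)) = fun _ => 0 := by
          refine Continuous.ext_on (dense_compl_singleton (0 : ℝ)) (by fun_prop)
            continuous_const fun s hs => ?_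
          refine hmul _ (fun a ha => ?_) ?_
          · rw [dotProduct_add, dotProduct_smul, ht a ha,
              hvC _ (Submodule.subset_span (Set.mem_image_of_mem X ha))]
            simp
          · rw [dotProduct_add, dotProduct_smul, hxt, zero_add]
            exact mul_ne_zero hs hv
        simpa using congrFun hline 0
      · exact hmul t ht hxt

theorem eval_linForm (y t : Fin n → ℝ) :
    MvPolynomial.eval (fun k => (t k : ℂ)) (linForm y) = ((y ⬝ᵥ t : ℝ) : ℂ) := by
  simp [linForm, dotProduct]

theorem notMem_span_lt_of_mem_bases [LinearOrder ι] {X : ι → (Fin n → ℝ)} {B : Finset ι}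
    (hB : B ∈ bases X) {x : ι} (hx : x ∈ B) :
    X x ∉ Submodule.span ℝ (X '' {b | b ∈ B ∧ b < x}) := by
  have h := hB.1.notMem_span_image (s := {b : B | (b : ι) < x}) (x := ⟨x, hx⟩) (by simp)
  convert h using 3
  ext v
  simp only [Set.mem_image, Set.mem_ofPred_eq, Subtype.exists]
  constructor
  · rintro ⟨b, ⟨h1, h2⟩, rfl⟩
    exact ⟨b, h1, h2, rfl⟩
  · rintro ⟨b, h1, h2, rfl⟩
    exact ⟨b, ⟨h1, h2⟩, rfl⟩

/-- The polynomials `Q_B`, for `B ∈ 𝔹(X)`, are linearly independent. -/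
theorem linearIndependent_basisPoly [Fintype ι] [LinearOrder ι] (X : ι → (Fin n → ℝ)) :
    LinearIndepOn ℂ (basisPoly X) (bases X) := by
  classical
  rw [LinearIndepOn, Fintype.linearIndependent_iff]
  intro g hg
  set c : Finset ι → ℂ := fun B => if h : B ∈ bases X then g ⟨B, h⟩ else 0 with hc
  have key : ∀ B, c B = 0 := by
    refine coeff_eq_zero_of_sum_passive X univ ∅ c (by simp) ?_ ?_
    · intro B hB
      have hB' : B ∈ bases X := by
        by_contra h
        simp [hc, h] at hB
      exact ⟨fun x hx => notMem_span_lt_of_mem_bases hB' hx, by simp, by simp⟩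
    · intro t _
      have := congrArg (MvPolynomial.eval (fun k => (t k : ℂ))) hg
      simp only [map_sum, MvPolynomial.smul_eval, map_zero, basisPoly, prodForm, map_prod,
        eval_linForm, passiveSet_eq] at this
      rw [← this, ← Finset.sum_subset (Finset.subset_univ (univ.filter (· ∈ bases X)))]
      · rw [Finset.sum_subtype (univ.filter (· ∈ bases X)) (p := (· ∈ bases X)) (by simp)]
        refine Finset.sum_congr rfl fun B _ => ?_
        simp [hc]
      · intro B _ hB
        simp only [mem_filter, mem_univ, true_and] at hB
        simp [hc, hB]
  intro B
  simpa [hc] using key B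

/-! ### Greedy bases and straightening -/

theorem linForm_sum_smul (s : Finset ι) (a : ι → ℝ) (X : ι → (Fin n → ℝ)) :
    linForm (∑ i ∈ s, a i • X i) = ∑ i ∈ s, (a i : ℂ) • linForm (X i) := by
  simp only [linForm, Finset.sum_apply, Pi.smul_apply, smul_eq_mul, Complex.ofReal_sum,
    Complex.ofReal_mul, map_sum, map_mul, sum_mul, smul_sum, MvPolynomial.smul_eq_C_mul]
  rw [sum_comm]
  simp only [mul_assoc]

theorem linearIndepOn_of_notMem_span_lt [LinearOrder ι] {X : ι → (Fin n → ℝ)} (B : Finset ι) :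
    (∀ x ∈ B, X x ∉ Submodule.span ℝ (X '' {b | b ∈ B ∧ b < x})) →
      LinearIndepOn ℝ X (B : Set ι) := by
  induction B using Finset.induction_on_max with
  | empty => intro _; simp
  | insert x B hx ih =>
    intro h
    have hxB : {b | b ∈ insert x B ∧ b < x} = (B : Set ι) := by
      ext b
      simp only [mem_insert, Set.mem_ofPred_eq, mem_coe]
      constructor
      · rintro ⟨rfl | hb, hbx⟩
        · exact absurd hbx (lt_irrefl _)
        · exact hb
      · exact fun hb => ⟨Or.inr hb, hx b hb⟩
    rw [coe_insert]
    refine (ih fun y hy hmem => h y (mem_insert_of_mem hy) ?_).insert ?_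
    · refine Submodule.span_mono (Set.image_mono ?_) hmem
      exact fun b hb => ⟨mem_insert_of_mem hb.1, hb.2⟩
    · rw [← hxB]
      exact h x (mem_insert_self _ _)

/-- A spanning family contains a greedy basis `B`: each `y ∉ Y` lies in `span {b ∈ B : b ⪯ y}`. -/
theorem exists_greedy_basis [Fintype ι] [LinearOrder ι] {X : ι → (Fin n → ℝ)} {Y : Finset ι}
    (hY : Submodule.span ℝ (X '' ((Y : Set ι)ᶜ)) = ⊤) :
    ∃ B ∈ bases X, Disjoint B Y ∧
      ∀ y ∉ Y, X y ∈ Submodule.span ℝ (X '' {b | b ∈ B ∧ b ≤ y}) := by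
  classical
  -- Keep each element outside `Y` that is not spanned by the smaller elements outside `Y`.
  set B : Finset ι :=
    univ.filter fun y => y ∉ Y ∧ X y ∉ Submodule.span ℝ (X '' {b | b ∉ Y ∧ b < y}) with hB
  have hmem : ∀ y, y ∈ B ↔ y ∉ Y ∧ X y ∉ Submodule.span ℝ (X '' {b | b ∉ Y ∧ b < y}) := by
    simp [hB]
  have hgreedy : ∀ y, y ∉ Y → X y ∈ Submodule.span ℝ (X '' {b | b ∈ B ∧ b ≤ y}) := by
    intro y
    induction y using WellFoundedLT.induction with
    | ind y ih =>
      intro hy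
      by_cases hyB : y ∈ B
      · exact Submodule.subset_span (Set.mem_image_of_mem X ⟨hyB, le_rfl⟩)
      · have h : X y ∈ Submodule.span ℝ (X '' {b | b ∉ Y ∧ b < y}) := by
          by_contra h
          exact hyB ((hmem y).2 ⟨hy, h⟩)
        refine Submodule.span_le.2 ?_ h
        rintro _ ⟨b, ⟨hbY, hby⟩, rfl⟩
        refine Submodule.span_mono (Set.image_mono ?_) (ih b hby hbY)
        exact fun b' hb' => ⟨hb'.1, hb'.2.trans hby.le⟩
  refine ⟨B, ⟨?_, ?_⟩, ?_, hgreedy⟩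
  · refine linearIndepOn_of_notMem_span_lt B fun x hx h => ((hmem x).1 hx).2 ?_
    refine Submodule.span_mono (Set.image_mono ?_) h
    exact fun b hb => ⟨((hmem b).1 hb.1).1, hb.2⟩
  · rw [eq_top_iff, ← hY, Submodule.span_le]
    rintro _ ⟨b, hb, rfl⟩
    exact Submodule.span_mono (Set.image_mono fun b' hb' => hb'.1) (hgreedy b hb)
  · rw [Finset.disjoint_left]
    exact fun b hb => ((hmem b).1 hb).1

/-- Supplies integer weights: exchanging an element of a finset for a smaller new one lowers the
total weight, which makes the exchange arguments below terminate. -/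
theorem exists_strictMono_nat (ι : Type*) [Fintype ι] [LinearOrder ι] :
    ∃ r : ι → ℕ, StrictMono r := by
  refine ⟨fun i => #{j | j < i}, fun i j hij => card_lt_card ?_⟩
  refine ⟨fun k hk => ?_, fun h => ?_⟩
  · simp only [mem_filter, mem_univ, true_and] at hk ⊢
    exact hk.trans hij
  · have := h (by simpa using hij : i ∈ ({k | k < j} : Finset ι))
    simp at this

/-- Straightening: every `p_Y` with `X \ Y` of full rank is a combination of the `Q_B`. -/
theorem prodForm_mem_span_basisPoly [Fintype ι] [LinearOrder ι] (X : ι → (Fin n → ℝ))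
    (Y : Finset ι) (hY : Submodule.span ℝ (X '' ((Y : Set ι)ᶜ)) = ⊤) :
    prodForm X Y ∈ Submodule.span ℂ (basisPoly X '' bases X) := by
  obtain ⟨r, hr⟩ := exists_strictMono_nat ι
  induction h : ∑ i ∈ Y, r i using Nat.strong_induction_on generalizing Y with
  | _ N ih =>
    subst h
    obtain ⟨B, hB, hBY, hgreedy⟩ := exists_greedy_basis hY
    have hsub : passiveSet X B ⊆ Y := fun i hi => by
      by_contra h
      exact (mem_passiveIn.1 hi).2 (hgreedy i h)
    by_cases hYB : Y ⊆ passiveSet X B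
    · exact Submodule.subset_span ⟨B, hB, by rw [basisPoly, hsub.antisymm hYB]⟩
    obtain ⟨y, hyY, hy⟩ := Finset.not_subset.1 hYB
    rw [passiveSet_eq, mem_passiveIn] at hy
    simp only [mem_univ, true_and, not_not] at hy
    have hcoe : {b | b ∈ B ∧ b ≤ y} = ((B.filter (· ≤ y) : Finset ι) : Set ι) := by
      ext b; simp
    rw [hcoe, Submodule.mem_span_image_finset_iff_exists_fun'] at hy
    obtain ⟨a, ha⟩ := hy
    -- Expand `X y` in the elements `b ⪯ y` of the greedy basis. They lie outside `Y`, so `b ≠ y`,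
    -- and each exchange of `y` for `b` lowers the weight.
    have hprod : prodForm X Y =
        ∑ b ∈ B.filter (· ≤ y), (a b : ℂ) • prodForm X (insert b (Y.erase y)) := by
      rw [prodForm, ← Finset.mul_prod_erase Y _ hyY, ← ha, linForm_sum_smul, sum_mul]
      refine Finset.sum_congr rfl fun b hb => ?_
      rw [prodForm, prod_insert, smul_mul_assoc]
      exact fun h => Finset.disjoint_left.1 hBY (mem_filter.1 hb).1 (mem_of_mem_erase h)
    rw [hprod]
    refine Submodule.sum_mem _ fun b hb => ?_
    by_cases hab : a b = 0
    · simp [hab]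
    have hbB : b ∈ B := (mem_filter.1 hb).1
    have hbY : b ∉ Y := Finset.disjoint_left.1 hBY hbB
    have hby : b < y := lt_of_le_of_ne (mem_filter.1 hb).2 fun h => hbY (h ▸ hyY)
    refine Submodule.smul_mem _ _ (ih _ ?_ _ ?_ rfl)
    · rw [sum_insert (fun h => hbY (mem_of_mem_erase h)), ← Finset.add_sum_erase Y _ hyY]
      have := hr hby
      omega
    · set V := Submodule.span ℝ (X '' (((insert b (Y.erase y) : Finset ι) : Set ι)ᶜ)) with hV
      have hother : ∀ b' ∈ B, b' ≠ b → X b' ∈ V := by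
        intro b' hb' hne
        refine Submodule.subset_span (Set.mem_image_of_mem X ?_)
        simp only [coe_insert, coe_erase, Set.mem_compl_iff, Set.mem_insert_iff, hne, false_or]
        exact fun h => Finset.disjoint_left.1 hBY hb' h.1
      have hyV : X y ∈ V := by
        refine Submodule.subset_span (Set.mem_image_of_mem X ?_)
        simp [hby.ne']
      -- Steinitz exchange: as `a b ≠ 0`, the relation can be solved for `X b`, so the new
      -- complement still spans.
      have hbV : X b ∈ V := by
        rw [← Finset.add_sum_erase _ _ hb] at ha
        have h1 : a b • X b ∈ V := by
          rw [eq_sub_of_add_eq ha]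
          refine V.sub_mem hyV (V.sum_mem fun b' hb' => V.smul_mem _ (hother b' ?_ ?_))
          · exact (mem_filter.1 (mem_of_mem_erase hb')).1
          · exact ne_of_mem_erase hb'
        exact (V.smul_mem_iff hab).1 h1
      rw [eq_top_iff, ← hB.2, Submodule.span_le]
      rintro _ ⟨b', hb', rfl⟩
      by_cases hne : b' = b
      · rw [hne]; exact hbV
      · exact hother b' hb' hne

theorem centralSpace_univ_le [Fintype ι] [LinearOrder ι] (X : ι → (Fin n → ℝ)) :
    centralSpace X univ ≤ Submodule.span ℂ (basisPoly X '' bases X) := by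
  refine Submodule.span_le.2 ?_
  rintro _ ⟨Y, _, hY, rfl⟩
  refine prodForm_mem_span_basisPoly X Y ?_
  rwa [coe_univ, ← Set.compl_eq_univ_sdiff] at hY

theorem internalSpace_le_centralSpace_univ [Fintype ι] [LinearOrder ι] {X : ι → (Fin n → ℝ)}
    (hX : Submodule.span ℝ (Set.range X) = ⊤) : internalSpace X ≤ centralSpace X univ := by
  rcases isEmpty_or_nonempty ι with hι | ⟨⟨x⟩⟩
  -- With `X` empty the intersection is all of Π. Spanning forces n = 0, where Π consists of the
  -- constants, spanned by p_∅ = 1.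
  · have hn : n = 0 := by
      rw [Set.range_eq_empty, Submodule.span_empty] at hX
      have := (finrank_top ℝ (Fin n → ℝ)).symm
      rw [← hX] at this
      simpa using this
    subst hn
    intro f _
    rw [MvPolynomial.eq_C_of_isEmpty f, ← mul_one (MvPolynomial.C _), ← MvPolynomial.smul_eq_C_mul]
    exact Submodule.smul_mem _ _
      (Submodule.subset_span ⟨∅, by simp, Subsingleton.elim _ _, by simp [prodForm]⟩)
  · refine (iInf_le _ x).trans (Submodule.span_mono ?_)
    rintro _ ⟨Y, _, hY, rfl⟩
    refine ⟨Y, subset_univ _, ?_, rfl⟩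
    rw [eq_top_iff, ← hY]
    exact Submodule.span_mono (Set.image_mono (Set.sdiff_subset_sdiff_left (by simp)))

/-! ### Degrees along lines -/

/-- Restriction of a polynomial to the line `s ↦ t + s η`. -/
noncomputable def lineRestrict (t η : Fin n → ℝ) : MvPolynomial (Fin n) ℂ →ₐ[ℂ] Polynomial ℂ :=
  MvPolynomial.aeval fun k =>
    Polynomial.C (t k : ℂ) + Polynomial.C (η k : ℂ) * Polynomial.X

theorem lineRestrict_linForm (t η y : Fin n → ℝ) :
    lineRestrict t η (linForm y) = Polynomial.C ((y ⬝ᵥ t : ℝ) : ℂ) +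
      Polynomial.C ((y ⬝ᵥ η : ℝ) : ℂ) * Polynomial.X := by
  simp only [lineRestrict, linForm, map_sum, map_mul, MvPolynomial.aeval_X, MvPolynomial.aeval_C,
    Polynomial.algebraMap_eq, dotProduct, Complex.ofReal_sum, Complex.ofReal_mul, sum_mul,
    ← sum_add_distrib]
  exact Finset.sum_congr rfl fun k _ => by ring

/-- The coefficient of `p_Y` along the line `t + s η` in its expected top degree. -/
theorem coeff_lineRestrict_prodForm [DecidableEq ι] (X : ι → (Fin n → ℝ)) (t η : Fin n → ℝ)
    (Y : Finset ι) (m : ℕ) (hm : #{i ∈ Y | X i ⬝ᵥ η ≠ 0} ≤ m) :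
    (lineRestrict t η (prodForm X Y)).coeff m =
      if #{i ∈ Y | X i ⬝ᵥ η ≠ 0} = m then
        (∏ i ∈ Y with X i ⬝ᵥ η ≠ 0, ((X i ⬝ᵥ η : ℝ) : ℂ)) *
          ∏ i ∈ Y with X i ⬝ᵥ η = 0, ((X i ⬝ᵥ t : ℝ) : ℂ)
      else 0 := by
  have hsplit : lineRestrict t η (prodForm X Y) =
      (∏ i ∈ Y with X i ⬝ᵥ η ≠ 0, (Polynomial.C ((X i ⬝ᵥ t : ℝ) : ℂ) +
        Polynomial.C ((X i ⬝ᵥ η : ℝ) : ℂ) * Polynomial.X)) *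
      Polynomial.C (∏ i ∈ Y with X i ⬝ᵥ η = 0, ((X i ⬝ᵥ t : ℝ) : ℂ)) := by
    rw [prodForm, map_prod, ← Finset.prod_filter_mul_prod_filter_not Y (fun i => X i ⬝ᵥ η ≠ 0),
      map_prod]
    simp only [not_not]
    congr 1
    · exact Finset.prod_congr rfl fun i _ => lineRestrict_linForm _ _ _
    · refine Finset.prod_congr rfl fun i hi => ?_
      rw [lineRestrict_linForm, (mem_filter.1 hi).2]
      simp
  have hdeg : ∀ i ∈ Y.filter (fun i => X i ⬝ᵥ η ≠ 0), (Polynomial.C ((X i ⬝ᵥ t : ℝ) : ℂ) +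
        Polynomial.C ((X i ⬝ᵥ η : ℝ) : ℂ) * Polynomial.X).natDegree ≤ 1 := by
    intro i _
    rw [add_comm]
    exact Polynomial.natDegree_linear_le
  rw [hsplit, Polynomial.coeff_mul_C]
  split_ifs with h
  · have := Polynomial.coeff_prod_of_natDegree_le (Y.filter (fun i => X i ⬝ᵥ η ≠ 0)) _ 1 hdeg
    rw [mul_one, h] at this
    rw [this]
    simp
  · rw [Polynomial.coeff_eq_zero_of_natDegree_lt, zero_mul]
    refine lt_of_le_of_lt ?_ (lt_of_le_of_ne hm h)
    refine (Polynomial.natDegree_prod_le _ _).trans ((Finset.sum_le_card_nsmul _ _ 1 hdeg).trans ?_)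
    simp

/-- Elements of `𝒫₋(X)` have degree at most `m - 2` along `η`, where `m = #{x ∈ X : x · η ≠ 0}`. -/
theorem coeff_lineRestrict_eq_zero [Fintype ι] [DecidableEq ι] {X : ι → (Fin n → ℝ)}
    {f : MvPolynomial (Fin n) ℂ} (hf : f ∈ internalSpace X) (t η : Fin n → ℝ) {x : ι}
    (hx : X x ⬝ᵥ η ≠ 0) :
    (lineRestrict t η f).coeff (#{i | X i ⬝ᵥ η ≠ 0} - 1) = 0 := by
  have hfx : f ∈ centralSpace X (univ.erase x) := (Submodule.mem_iInf _).1 hf x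
  clear hf
  have hη : η ≠ 0 := by
    rintro rfl
    simp at hx
  induction hfx using Submodule.span_induction with
  | mem p hp =>
    obtain ⟨Y, hYS, hY, rfl⟩ := hp
    obtain ⟨z, ⟨hzx, hzY⟩, hz⟩ : ∃ z ∈ ((univ.erase x : Finset ι) : Set ι) \ Y,
        X z ⬝ᵥ η ≠ 0 := by
      by_contra! h
      have hall : ∀ y : Fin n → ℝ, y ⬝ᵥ η = 0 := fun y => by
        refine dotProduct_eq_zero_of_mem_span (s := X '' (((univ.erase x : Finset ι) : Set ι) \ Y))
          ?_ (hY ▸ Submodule.mem_top)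
        rintro _ ⟨z, hz, rfl⟩
        exact h z hz
      exact hη (dotProduct_self_eq_zero.1 (hall η))
    have hzx' : z ≠ x := by simpa using hzx
    have hxY : x ∉ Y := fun h => (mem_erase.1 (hYS h)).1 rfl
    -- Two elements not orthogonal to `η` are missing from `Y`: the deleted `x`, and some `z ≠ x` in
    -- the spanning complement.
    have hcard : #{i ∈ Y | X i ⬝ᵥ η ≠ 0} + 2 ≤ #{i | X i ⬝ᵥ η ≠ 0} := by
      have hz1 : z ∉ insert x {i ∈ Y | X i ⬝ᵥ η ≠ 0} := by
        simp [hzx', show z ∉ Y from hzY]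
      have hx1 : x ∉ {i ∈ Y | X i ⬝ᵥ η ≠ 0} := by simp [hxY]
      have h2 := card_insert_of_notMem hz1
      rw [card_insert_of_notMem hx1] at h2
      refine h2.symm.le.trans (card_le_card fun i hi => ?_)
      simp only [mem_insert, mem_filter, mem_univ, true_and] at hi ⊢
      rcases hi with rfl | rfl | hi
      · exact hz
      · exact hx
      · exact hi.2
    rw [coeff_lineRestrict_prodForm X t η Y _ (by omega), if_neg (by omega)]
  | zero => simp
  | add p q _ _ hp hq => rw [map_add, Polynomial.coeff_add, hp, hq, add_zero]
  | smul a p _ hp => rw [map_smul, Polynomial.coeff_smul, hp, smul_zero]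

/-! ### The trivial intersection -/

theorem internalSpace_inf_exSpace [Fintype ι] [LinearOrder ι] (X : ι → (Fin n → ℝ)) :
    internalSpace X ⊓ exSpace X = ⊥ := by
  classical
  rw [eq_bot_iff]
  rintro f ⟨hfi, hfe⟩
  set E : Finset (Finset ι) := univ.filter (· ∈ bases X \ internalBases X) with hE
  have hEmem : ∀ B, B ∈ E ↔ B ∈ bases X \ internalBases X := by simp [hE]
  have hEcoe : bases X \ internalBases X = (E : Set (Finset ι)) := by
    ext B; simp [hEmem]
  obtain ⟨c, rfl⟩ : ∃ c : Finset ι → ℂ, ∑ B ∈ E, c B • basisPoly X B = f := by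
    rw [exSpace, hEcoe] at hfe
    exact (Submodule.mem_span_image_finset_iff_exists_fun' ℂ).1 hfe
  obtain ⟨r, hr⟩ := exists_strictMono_nat ι
  suffices h : ∀ B ∈ E, c B = 0 by
    rw [Submodule.mem_bot]
    exact Finset.sum_eq_zero fun B hB => by rw [h B hB, zero_smul]
  intro B₀ hB₀
  induction hN : ∑ i ∈ B₀, r i using Nat.strong_induction_on generalizing B₀ with
  | _ N ih =>
    subst hN
    obtain ⟨hB₀b, hB₀i⟩ := (hEmem B₀).1 hB₀
    obtain ⟨b, hbB₀, hb⟩ : ∃ b ∈ B₀, InternallyActive X B₀ b := by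
      by_contra! h
      exact hB₀i ⟨hB₀b, h⟩
    obtain ⟨η, hbη, hHη⟩ := exists_dotProduct_ne_zero hb.1
    have hbη' : ∀ i ∈ B₀, i ≠ b → X i ⬝ᵥ η = 0 := fun i hi hne =>
      hHη _ (Submodule.subset_span (Set.mem_image_of_mem X ⟨hi, hne⟩))
    -- This is where internal activity enters: `b` is the largest element not orthogonal to `η`.
    have hle : ∀ i, X i ⬝ᵥ η ≠ 0 → i ≤ b := fun i hi => hb.2 fun h => hi (hHη _ h)
    have hmemH : ∀ y : Fin n → ℝ, y ⬝ᵥ η = 0 →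
        y ∈ Submodule.span ℝ (X '' ((B₀ : Set ι) \ {b})) := by
      intro y hy
      have hy' : y ∈ Submodule.span ℝ (insert (X b) (X '' ((B₀ : Set ι) \ {b}))) := by
        rw [← Set.image_insert_eq, Set.insert_sdiff_singleton, Set.insert_eq_of_mem (by simpa),
          hB₀b.2]
        exact Submodule.mem_top
      obtain ⟨a, z, hz, rfl⟩ := Submodule.mem_span_insert.1 hy'
      rw [add_dotProduct, smul_dotProduct, hHη z hz, add_zero, smul_eq_mul, mul_eq_zero] at hy
      rw [hy.resolve_right hbη, zero_smul, zero_add]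
      exact hz
    have hη : η ≠ 0 := by
      rintro rfl
      simp at hbη
    set S : Finset ι := univ.filter fun i => X i ⬝ᵥ η = 0 with hS
    set T : Finset ι := univ.filter fun i => X i ⬝ᵥ η ≠ 0 with hT
    have hself : ∀ B : Finset ι, ∀ i ∈ B, i ∉ passiveSet X B := fun B i hi h =>
      (mem_passiveIn.1 h).2 (Submodule.subset_span (Set.mem_image_of_mem X ⟨hi, le_rfl⟩))
    -- every basis meets `T`, in elements that are not passive
    have hmeet : ∀ B ∈ E, ∃ z ∈ B, X z ⬝ᵥ η ≠ 0 := by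
      intro B hB
      by_contra! h
      refine hη (dotProduct_self_eq_zero.1 (dotProduct_eq_zero_of_mem_span (s := X '' (B : Set ι))
        ?_ (((hEmem B).1 hB).1.2 ▸ Submodule.mem_top)))
      rintro _ ⟨z, hz, rfl⟩
      exact h z hz
    have hcard : ∀ B ∈ E, #{i ∈ passiveSet X B | X i ⬝ᵥ η ≠ 0} ≤ #T - 1 := by
      intro B hB
      obtain ⟨z, hzB, hz⟩ := hmeet B hB
      rw [← card_erase_of_mem (show z ∈ T by simp [hT, hz])]
      refine card_le_card fun i hi => ?_
      rw [mem_filter] at hi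
      rw [mem_erase]
      exact ⟨fun h => hself B z hzB (h ▸ hi.1), by simpa [hT] using hi.2⟩
    -- In the top degree all elements of `T` but one are passive, hence outside `B`, so `B` meets
    -- `T` in a single element.
    have huniq : ∀ B ∈ E, #{i ∈ passiveSet X B | X i ⬝ᵥ η ≠ 0} = #T - 1 →
        ∃ z ∈ T, z ∉ S ∧ B = insert z (B ∩ S) := by
      intro B hB h
      obtain ⟨z, hzB, hz⟩ := hmeet B hB
      have hzT : z ∈ T := by simp [hT, hz]
      have heq : {i ∈ passiveSet X B | X i ⬝ᵥ η ≠ 0} = T.erase z := by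
        refine Finset.eq_of_subset_of_card_le (fun i hi => ?_) ?_
        · rw [mem_filter] at hi
          rw [mem_erase]
          exact ⟨fun h => hself B z hzB (h ▸ hi.1), by simpa [hT] using hi.2⟩
        · rw [card_erase_of_mem hzT, h]
      refine ⟨z, hzT, by simp [hS, hz], ?_⟩
      ext i
      rw [mem_insert, mem_inter]
      constructor
      · intro hi
        by_cases hiS : X i ⬝ᵥ η = 0
        · exact Or.inr ⟨hi, by simp [hS, hiS]⟩
        · left
          by_contra hne
          have : i ∈ T.erase z := mem_erase.2 ⟨hne, by simp [hT, hiS]⟩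
          rw [← heq, mem_filter] at this
          exact hself B i hi this.1
      · rintro (rfl | ⟨hi, _⟩)
        · exact hzB
        · exact hi
    -- The element `z` does not affect passivity inside `S`: pairing with `η` kills its coefficient
    -- in any expansion of a vector orthogonal to `η`.
    have hpassS : ∀ B ∈ E, #{i ∈ passiveSet X B | X i ⬝ᵥ η ≠ 0} = #T - 1 →
        {i ∈ passiveSet X B | X i ⬝ᵥ η = 0} = passiveIn X S (B ∩ S) := by
      intro B hB h
      obtain ⟨z, hzT, hzS, hBz⟩ := huniq B hB h
      have hzη : X z ⬝ᵥ η ≠ 0 := by simpa [hT] using hzT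
      ext i
      rw [mem_filter, passiveSet_eq, mem_passiveIn, mem_passiveIn, hS, mem_filter]
      simp only [mem_univ, true_and]
      rw [and_comm]
      refine and_congr_right fun hi => not_congr ⟨fun hmem => ?_, fun hmem => ?_⟩
      · have hsub : {b | b ∈ B ∧ b ≤ i} ⊆ insert z {b | b ∈ B ∩ S ∧ b ≤ i} := by
          rintro b' ⟨hb', hb'i⟩
          rw [hBz, mem_insert] at hb'
          rcases hb' with rfl | hb'
          · exact Or.inl rfl
          · exact Or.inr ⟨hb', hb'i⟩
        have h1 := Submodule.span_mono (Set.image_mono hsub) hmem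
        rw [Set.image_insert_eq] at h1
        obtain ⟨a, w, hw, hiw⟩ := Submodule.mem_span_insert.1 h1
        have hwη : w ⬝ᵥ η = 0 := by
          refine dotProduct_eq_zero_of_mem_span ?_ hw
          rintro _ ⟨b', hb', rfl⟩
          exact (mem_filter.1 (mem_inter.1 hb'.1).2).2
        rw [hiw, add_dotProduct, smul_dotProduct, hwη, add_zero, smul_eq_mul, mul_eq_zero] at hi
        rw [hiw, hi.resolve_right hzη, zero_smul, zero_add]
        exact hw
      · refine Submodule.span_mono (Set.image_mono ?_) hmem
        exact fun b' hb' => ⟨(mem_inter.1 hb'.1).1, hb'.2⟩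
    -- The scalar part of the top coefficient of Q_B, zero if Q_B has lower degree. The part
    -- depending on `t` involves only the trace `B ∩ S`, so `d` collects the bases by trace.
    set κ : Finset ι → ℂ := fun B =>
      if #{i ∈ passiveSet X B | X i ⬝ᵥ η ≠ 0} = #T - 1 then
        ∏ i ∈ passiveSet X B with X i ⬝ᵥ η ≠ 0, ((X i ⬝ᵥ η : ℝ) : ℂ) else 0 with hκ
    set d : Finset ι → ℂ := fun B' => ∑ B ∈ E with B ∩ S = B', c B * κ B with hd
    have hdzero : ∀ B', d B' = 0 := by
      refine coeff_eq_zero_of_sum_passive X S ∅ d (by simp) ?_ ?_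
      · intro B' hB'
        obtain ⟨B, hB, -⟩ := Finset.exists_ne_zero_of_sum_ne_zero hB'
        obtain ⟨hBE, rfl⟩ := mem_filter.1 hB
        refine ⟨fun x hx h => ?_, empty_subset _, by simp⟩
        refine notMem_span_lt_of_mem_bases ((hEmem B).1 hBE).1 (mem_inter.1 hx).1
          (Submodule.span_mono (Set.image_mono ?_) h)
        exact fun b' hb' => ⟨(mem_inter.1 hb'.1).1, hb'.2⟩
      · intro t _
        have h0 := coeff_lineRestrict_eq_zero hfi t η hbη
        rw [map_sum, Polynomial.finsetSum_coeff] at h0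
        rw [← h0, ← Finset.sum_fiberwise E (fun B => B ∩ S)]
        refine Finset.sum_congr rfl fun B' _ => ?_
        rw [hd, sum_mul]
        refine Finset.sum_congr rfl fun B hB => ?_
        obtain ⟨hBE, rfl⟩ := mem_filter.1 hB
        rw [map_smul, Polynomial.coeff_smul, basisPoly,
          coeff_lineRestrict_prodForm X t η _ _ (hcard B hBE), smul_eq_mul]
        by_cases h : #{i ∈ passiveSet X B | X i ⬝ᵥ η ≠ 0} = #T - 1
        · rw [if_pos h, hpassS B hBE h]
          simp only [hκ, if_pos h]
          ring
        · rw [if_neg h]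
          simp only [hκ, if_neg h]
          ring
    have hB₀S : B₀ ∩ S = B₀.erase b := by
      ext i
      rw [mem_inter, mem_erase, hS, mem_filter, and_comm]
      simp only [mem_univ, true_and]
      constructor
      · rintro ⟨hi, hiB⟩
        exact ⟨fun h => hbη (h ▸ hi), hiB⟩
      · rintro ⟨hne, hiB⟩
        exact ⟨hbη' i hiB hne, hiB⟩
    -- Any other basis with this trace either has `κ B = 0` or is `B₀` with `b` exchanged for some
    -- `z < b`; the latter has smaller weight, so its coefficient vanishes by induction.
    have hdB₀ : d (B₀ ∩ S) = c B₀ * κ B₀ := by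
      rw [hd]
      refine Finset.sum_eq_single_of_mem B₀ (mem_filter.2 ⟨hB₀, rfl⟩) fun B hB hne => ?_
      obtain ⟨hBE, hBS⟩ := mem_filter.1 hB
      by_cases h : #{i ∈ passiveSet X B | X i ⬝ᵥ η ≠ 0} = #T - 1
      · obtain ⟨z, hzT, hzS, hBz⟩ := huniq B hBE h
        rw [hBS, hB₀S] at hBz
        have hzb : z ≠ b := by
          rintro rfl
          exact hne (by rw [hBz, insert_erase hbB₀])
        have hlt : r z < r b := hr (lt_of_le_of_ne (hle z (by simpa [hT] using hzT)) hzb)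
        have hz : z ∉ B₀.erase b := by
          rw [← hB₀S]
          exact fun h => hzS (mem_inter.1 h).2
        rw [ih _ ?_ B hBE rfl, zero_mul]
        rw [hBz, sum_insert hz, ← Finset.add_sum_erase B₀ _ hbB₀]
        omega
      · simp only [hκ, if_neg h, mul_zero]
    -- For `i ∈ T` with `i ≠ b`, maximality gives `i < b`, so the elements of `B₀` up to `i` are all
    -- orthogonal to `η` and cannot span `X i`. Thus Q_{B₀} attains the top degree.
    have hpassT : {i ∈ passiveSet X B₀ | X i ⬝ᵥ η ≠ 0} = T.erase b := by
      ext i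
      rw [mem_filter, mem_erase, passiveSet_eq, mem_passiveIn, hT, mem_filter]
      simp only [mem_univ, true_and]
      constructor
      · rintro ⟨h, hi⟩
        refine ⟨?_, hi⟩
        rintro rfl
        exact h (Submodule.subset_span (Set.mem_image_of_mem X ⟨hbB₀, le_rfl⟩))
      · rintro ⟨hne, hi⟩
        refine ⟨fun h => hi (dotProduct_eq_zero_of_mem_span ?_ h), hi⟩
        rintro _ ⟨b', ⟨hb', hb'i⟩, rfl⟩
        refine hbη' b' hb' ?_
        rintro rfl
        exact hne (le_antisymm (hle i hi) hb'i)
    have hκ₀ : κ B₀ ≠ 0 := by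
      simp only [hκ]
      rw [hpassT, if_pos (card_erase_of_mem (by simp [hT, hbη])), prod_ne_zero_iff]
      intro i hi
      have : X i ⬝ᵥ η ≠ 0 := by simpa [hT] using mem_of_mem_erase hi
      exact_mod_cast this
    have := hdzero (B₀ ∩ S)
    rw [hdB₀] at this
    exact (mul_eq_zero.1 this).resolve_right hκ₀

/-! ### The dimension bound -/

theorem rank_internalSpace_le [Fintype ι] [LinearOrder ι] {X : ι → (Fin n → ℝ)}
    (hX : Submodule.span ℝ (Set.range X) = ⊤) :
    Module.rank ℂ (internalSpace X) ≤ ((internalBases X).ncard : Cardinal) := by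
  classical
  set Z := Submodule.span ℂ (basisPoly X '' bases X) with hZ
  have hfin : (basisPoly X '' bases X).Finite := Set.toFinite _
  have : FiniteDimensional ℂ Z := FiniteDimensional.span_of_finite ℂ hfin
  have hP : internalSpace X ≤ Z :=
    (internalSpace_le_centralSpace_univ hX).trans (centralSpace_univ_le X)
  have hex : exSpace X ≤ Z := Submodule.span_mono (Set.image_mono Set.sdiff_subset)
  have : FiniteDimensional ℂ (internalSpace X) := Submodule.finiteDimensional_of_le hP
  have : FiniteDimensional ℂ (exSpace X) := Submodule.finiteDimensional_of_le hex
  -- The sum of the two spaces is direct and lies in `Z`, so their dimensions add up to at most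
  -- #𝔹(X); independence of the Q_B makes the second exactly #(𝔹(X) \ 𝔹₋(X)).
  have h1 := Submodule.finrank_sup_add_finrank_inf_eq (internalSpace X) (exSpace X)
  rw [internalSpace_inf_exSpace, finrank_bot, add_zero] at h1
  have h2 : Module.finrank ℂ ↥(internalSpace X ⊔ exSpace X) ≤ Module.finrank ℂ Z :=
    Submodule.finrank_mono (sup_le hP hex)
  have h3 : Module.finrank ℂ Z ≤ (bases X).ncard := by
    have := finrank_span_le_card (R := ℂ) (basisPoly X '' bases X)
    rw [← Set.ncard_eq_toFinset_card'] at this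
    exact this.trans (Set.ncard_image_le (Set.toFinite _))
  have h4 : Module.finrank ℂ (exSpace X) = (bases X \ internalBases X).ncard := by
    have hli : LinearIndepOn ℂ (basisPoly X) (bases X \ internalBases X) :=
      (linearIndependent_basisPoly X).mono Set.sdiff_subset
    have := finrank_span_eq_card hli
    rw [exSpace, Set.image_eq_range, this, ← Nat.card_eq_fintype_card, Nat.card_coe_set_eq]
  have h5 : (bases X \ internalBases X).ncard + (internalBases X).ncard = (bases X).ncard :=
    Set.ncard_sdiff_add_ncard_of_subset (fun B hB => hB.1) (Set.toFinite _)
  rw [← Module.finrank_eq_rank]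
  exact_mod_cast (show Module.finrank ℂ (internalSpace X) ≤ (internalBases X).ncard by omega)

end

end Zonotopal

theorem mainTheorem10 {ι : Type*} [Fintype ι] [LinearOrder ι] (n : ℕ) (X : ι → (Fin n → ℝ))
    (hX0 : ∀ i, X i ≠ 0) (hXspan : Submodule.span ℝ (Set.range X) = ⊤) :
    Zonotopal.internalSpace X ⊓ Zonotopal.exSpace X = ⊥ ∧
      Module.rank ℂ (Zonotopal.internalSpace X) ≤ ((Zonotopal.internalBases X).ncard : Cardinal) :=
  ⟨Zonotopal.internalSpace_inf_exSpace X, Zonotopal.rank_internalSpace_le hXspan⟩
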